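/- Let $R$ be a commutative integral domain, and consider an irreducible reduced crystallographic root system (i.e. the root system of a simple complex Lie algebra) with base of simple roots $\Delta$, Weyl group $W$ and root lattice $Q=\bigoplus_{\alpha\in\Delta}\mathbb{Z}\alpha$. A root is called short if it has minimal length among all roots (so in the simply laced types all roots are short). Put $\mathfrak{h}^* := R\otimes_{\mathbb{Z}}Q$, with the induced action of $W$, and let $H = RW\ltimes \mathrm{Sym}_R(\mathfrak{h}^*)$ be the degenerate affine Hecke algebra with trivial parameter: the $R$-algebra generated by the group ring $RW$ and the $R$-module $\mathfrak{h}^*$ with relations $vv'=v'v$ and $wvw^{-1}=w(v)$ for $v,v'\in\mathfrak{h}^*$, $w\in W$. It is a Hopf algebra in which the elements of $W$ are grouplike and the elements of $\mathfrak{h}^*$ are primitive; let $\varepsilon$ be its counit, so $\varepsilon(w)=1$ and $\varepsilon(v)=0$. A weight of $H$ is an $R$-algebra map $H\to R$; the weights form a group $\Gamma$ under convolution, with identity $\varepsilon$. For a finite subgroup $\Pi\subset\Gamma$ put $\Sigma_\Pi:=\sum_{\gamma\in\Pi}\gamma : H\to R$. 1. If $\mathrm{char}\,R\neq 2$, or the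 root system is of type $G_2$, or there is more than one short simple root, then $\gamma(v)=\varepsilon(v)=0$ for every weight $\gamma$ and every $v\in\mathfrak{h}^*$. In particular, for every finite subgroup $\Pi\subset\Gamma$ and every $x\in\mathrm{Sym}_R(\mathfrak{h}^*)$, $\Sigma_\Pi(x)=|\Pi|\,\varepsilon(x)$; thus $\Sigma_\Pi$ vanishes on the augmentation ideal $\mathfrak{h}^*\cdot\mathrm{Sym}_R(\mathfrak{h}^*)$. 2. If $\mathrm{char}\,R=2$, then $\gamma(w)=\varepsilon(w)=1$ for every weight $\gamma$ and every $w\in W$. Suppose moreover that the type is not $G_2$ and that there is exactly one short simple root $\alpha_s$, and let $\Pi\subset\Gamma$ be a finite subgroup. If $h_1,\dots,h_n\in\mathfrak{h}^*$ and either $\Pi$ contains an element of order $4$, or $h_i\in\bigoplus_{\alpha\in\Delta,\ \alpha\ne\alpha_s}R\alpha$ for some $i$, then $\Sigma_\Pi(h_1\cdots h_n)=0$. 3. Keep the assumptions of part 2 on $R$ and on the root system. If $\Pi$ has no element of order $4$, then $\Pi\cong(\mathbb{Z}/2\mathbb{Z})^k$ for some $k\ge 0$. If $\Pi\cong(\mathbb{Z}/2\mathbb{Z})^k$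 and $\gamma_1,\dots,\gamma_k$ are any $k$ elements generating $\Pi$, then for all $n\ge0$ $$\Sigma_\Pi(\alpha_s^n)=\sum_{\substack{l_1,\dots,l_k>0\\ l_1+\dots+l_k=n}}\binom{n}{l_1,\dots,l_k}\prod_{i=1}^k\gamma_i(\alpha_s)^{l_i}.$$ In particular $\Sigma_\Pi(\alpha_s^n)=0$ if $k>r$, where $n=\sum_{j=1}^r 2^{s_j}$ (with distinct $s_j$) is the binary expansion of $n$; that is, if $k$ exceeds the number of digits $1$ in the binary expansion of $n$. -/

import Mathlib

open scoped TensorProduct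

noncomputable section

/-! ### The smash product `R[G] ⋉ Sym_R V` -/

section SmashProductDef

variable {R G V : Type*} [CommRing R] [Group G] [AddCommGroup V] [Module R V]

/-- The defining relations of `R[G] ⋉ Sym_R V`: the generators `inl g` multiply as in `G`, the
generators `inr v` depend `R`-linearly on `v` and commute with each other, and
`g v g⁻¹ = g(v)`. -/
inductive SmashProduct.Rel (ρ : Representation R G V) :
    FreeAlgebra R (G ⊕ V) → FreeAlgebra R (G ⊕ V) → Prop
  | one : Rel ρ (FreeAlgebra.ι R (Sum.inl 1)) 1
  | mul (g h : G) : Rel ρ (FreeAlgebra.ι R (Sum.inl (g * h)))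
      (FreeAlgebra.ι R (Sum.inl g) * FreeAlgebra.ι R (Sum.inl h))
  | add (v w : V) : Rel ρ (FreeAlgebra.ι R (Sum.inr (v + w)))
      (FreeAlgebra.ι R (Sum.inr v) + FreeAlgebra.ι R (Sum.inr w))
  | smul (r : R) (v : V) : Rel ρ (FreeAlgebra.ι R (Sum.inr (r • v)))
      (r • FreeAlgebra.ι R (Sum.inr v))
  | comm (v w : V) : Rel ρ (FreeAlgebra.ι R (Sum.inr v) * FreeAlgebra.ι R (Sum.inr w))
      (FreeAlgebra.ι R (Sum.inr w) * FreeAlgebra.ι R (Sum.inr v))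
  | conj (g : G) (v : V) :
      Rel ρ (FreeAlgebra.ι R (Sum.inl g) * FreeAlgebra.ι R (Sum.inr v) *
          FreeAlgebra.ι R (Sum.inl g⁻¹))
        (FreeAlgebra.ι R (Sum.inr (ρ g v)))

/-- The smash product `R[G] ⋉ Sym_R V` of the group ring of `G` with the symmetric algebra of a
representation `V` of `G`, by generators and relations. -/
def SmashProduct (ρ : Representation R G V) : Type _ := RingQuot (SmashProduct.Rel ρ)

namespace SmashProduct

variable (ρ : Representation R G V)

instance : Ring (SmashProduct ρ) := inferInstanceAs (Ring (RingQuot (Rel ρ)))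

instance : Algebra R (SmashProduct ρ) := inferInstanceAs (Algebra R (RingQuot (Rel ρ)))

/-- The quotient map from the free algebra. -/
def mk : FreeAlgebra R (G ⊕ V) →ₐ[R] SmashProduct ρ := RingQuot.mkAlgHom R (Rel ρ)

lemma mk_rel {x y : FreeAlgebra R (G ⊕ V)} (h : Rel ρ x y) : mk ρ x = mk ρ y :=
  RingQuot.mkAlgHom_rel R h

/-- The canonical map `G → R[G] ⋉ Sym_R V`. -/
def of : G →* SmashProduct ρ where
  toFun g := mk ρ (FreeAlgebra.ι R (Sum.inl g))
  map_one' := by rw [mk_rel ρ Rel.one, map_one]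
  map_mul' g h := by rw [mk_rel ρ (Rel.mul g h), map_mul]

/-- The canonical map `V → R[G] ⋉ Sym_R V`. -/
def ι : V →ₗ[R] SmashProduct ρ where
  toFun v := mk ρ (FreeAlgebra.ι R (Sum.inr v))
  map_add' v w := by rw [mk_rel ρ (Rel.add v w), map_add]
  map_smul' r v := by rw [mk_rel ρ (Rel.smul r v), map_smul, RingHom.id_apply]

lemma ι_mul_comm (v w : V) : ι ρ v * ι ρ w = ι ρ w * ι ρ v := by
  have := mk_rel ρ (Rel.comm v w)
  rw [map_mul, map_mul] at this
  exact this

lemma of_mul_ι_mul_of_inv (g : G) (v : V) : of ρ g * ι ρ v * of ρ g⁻¹ = ι ρ (ρ g v) := by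
  have := mk_rel ρ (Rel.conj g v)
  rw [map_mul, map_mul] at this
  exact this

variable {ρ} {A : Type*} [Ring A] [Algebra R A]

/-- The universal property of the smash product. -/
def lift (f : G →* A) (φ : V →ₗ[R] A) (hcomm : ∀ v w, φ v * φ w = φ w * φ v)
    (hconj : ∀ g v, f g * φ v * f g⁻¹ = φ (ρ g v)) : SmashProduct ρ →ₐ[R] A :=
  RingQuot.liftAlgHom R ⟨FreeAlgebra.lift R (Sum.elim f φ), by
    intro x y h
    induction h <;> simp [hcomm _ _, hconj]⟩

@[simp] lemma lift_of (f : G →* A) (φ : V →ₗ[R] A) (hcomm) (hconj) (g : G) :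
    lift (ρ := ρ) f φ hcomm hconj (of ρ g) = f g := by
  change RingQuot.liftAlgHom R _ (RingQuot.mkAlgHom R (Rel ρ) _) = _
  rw [RingQuot.liftAlgHom_mkAlgHom_apply]
  simp

@[simp] lemma lift_ι (f : G →* A) (φ : V →ₗ[R] A) (hcomm) (hconj) (v : V) :
    lift (ρ := ρ) f φ hcomm hconj (ι ρ v) = φ v := by
  change RingQuot.liftAlgHom R _ (RingQuot.mkAlgHom R (Rel ρ) _) = _
  rw [RingQuot.liftAlgHom_mkAlgHom_apply]
  simp

lemma algHom_ext {A : Type*} [Semiring A] [Algebra R A] {f f' : SmashProduct ρ →ₐ[R] A}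
    (h₁ : ∀ g, f (of ρ g) = f' (of ρ g)) (h₂ : ∀ v, f (ι ρ v) = f' (ι ρ v)) : f = f' := by
  apply RingQuot.ringQuot_ext'
  apply FreeAlgebra.hom_ext
  funext x
  rcases x with g | v
  · exact h₁ g
  · exact h₂ v

@[elab_as_elim]
lemma induction {motive : SmashProduct ρ → Prop}
    (algebraMap : ∀ r, motive (algebraMap R (SmashProduct ρ) r))
    (of : ∀ g, motive (of ρ g)) (ι : ∀ v, motive (ι ρ v))
    (mul : ∀ a b, motive a → motive b → motive (a * b))
    (add : ∀ a b, motive a → motive b → motive (a + b))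
    (a : SmashProduct ρ) : motive a := by
  obtain ⟨a, rfl⟩ : ∃ x, mk ρ x = a := RingQuot.mkAlgHom_surjective R (Rel ρ) a
  induction a using FreeAlgebra.induction with
  | grade0 r => rw [AlgHom.commutes]; exact algebraMap r
  | grade1 x =>
    rcases x with g | v
    · exact of g
    · exact ι v
  | mul x y hx hy => rw [map_mul]; exact mul _ _ hx hy
  | add x y hx hy => rw [map_add]; exact add _ _ hx hy

variable (ρ)

/-- The multiplicative map `g ↦ g ⊗ g`. -/
def diagHom : G →* SmashProduct ρ ⊗[R] SmashProduct ρ where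
  toFun g := of ρ g ⊗ₜ of ρ g
  map_one' := by simp [Algebra.TensorProduct.one_def]
  map_mul' := by simp

lemma diagHom_apply (g : G) : diagHom ρ g = of ρ g ⊗ₜ of ρ g := rfl

/-- The multiplicative map `g ↦ g⁻¹` to the opposite algebra. -/
def invHom : G →* (SmashProduct ρ)ᵐᵒᵖ where
  toFun g := MulOpposite.op (of ρ g⁻¹)
  map_one' := by simp
  map_mul' g h := by rw [mul_inv_rev, map_mul, MulOpposite.op_mul]

lemma invHom_apply (g : G) : invHom ρ g = MulOpposite.op (of ρ g⁻¹) := rfl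

/-- The comultiplication: `g ↦ g ⊗ g` and `v ↦ 1 ⊗ v + v ⊗ 1`. -/
def comulHom : SmashProduct ρ →ₐ[R] SmashProduct ρ ⊗[R] SmashProduct ρ :=
  lift (diagHom ρ)
    ((TensorProduct.mk R (SmashProduct ρ) (SmashProduct ρ) 1 +
      (TensorProduct.mk R (SmashProduct ρ) (SmashProduct ρ)).flip 1) ∘ₗ ι ρ)
    (by
      intro v w
      simp only [LinearMap.comp_apply, LinearMap.add_apply, TensorProduct.mk_apply,
        LinearMap.flip_apply, mul_add, add_mul, Algebra.TensorProduct.tmul_mul_tmul, one_mul,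
        mul_one, ι_mul_comm ρ v w]
      abel)
    (by
      intro g v
      have h : of ρ g * of ρ g⁻¹ = 1 := by rw [← map_mul, mul_inv_cancel, map_one]
      simp only [diagHom_apply, LinearMap.comp_apply, LinearMap.add_apply,
        TensorProduct.mk_apply, LinearMap.flip_apply, mul_add, add_mul,
        Algebra.TensorProduct.tmul_mul_tmul, mul_one, of_mul_ι_mul_of_inv, h])

@[simp] lemma comulHom_of (g : G) : comulHom ρ (of ρ g) = of ρ g ⊗ₜ of ρ g :=
  lift_of _ _ _ _ g

@[simp] lemma comulHom_ι (v : V) : comulHom ρ (ι ρ v) = 1 ⊗ₜ ι ρ v + ι ρ v ⊗ₜ 1 :=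
  lift_ι _ _ _ _ v

/-- The counit: `g ↦ 1` and `v ↦ 0`. -/
def counitHom : SmashProduct ρ →ₐ[R] R :=
  lift 1 0 (by simp) (by simp)

@[simp] lemma counitHom_of (g : G) : counitHom ρ (of ρ g) = 1 := by simp [counitHom]

@[simp] lemma counitHom_ι (v : V) : counitHom ρ (ι ρ v) = 0 := by simp [counitHom]

/-- The antipode, as an algebra map to the opposite algebra: `g ↦ g⁻¹` and `v ↦ -v`. -/
def antipodeHom : SmashProduct ρ →ₐ[R] (SmashProduct ρ)ᵐᵒᵖ :=
  lift (invHom ρ)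
    ((MulOpposite.opLinearEquiv R).toLinearMap ∘ₗ (-ι ρ))
    (by
      intro v w
      apply MulOpposite.unop_injective
      simp [ι_mul_comm ρ v w])
    (by
      intro g v
      apply MulOpposite.unop_injective
      have := of_mul_ι_mul_of_inv ρ g v
      simp [invHom_apply, ← this, mul_assoc])

@[simp] lemma antipodeHom_of (g : G) :
    antipodeHom ρ (of ρ g) = MulOpposite.op (of ρ g⁻¹) := by
  simp [antipodeHom, invHom_apply]

@[simp] lemma antipodeHom_ι (v : V) : antipodeHom ρ (ι ρ v) = MulOpposite.op (-ι ρ v) := by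
  simp [antipodeHom]

instance : Bialgebra R (SmashProduct ρ) :=
  Bialgebra.ofAlgHom (comulHom ρ) (counitHom ρ)
    (algHom_ext
      (by intro g; simp)
      (by
        intro v
        simp [TensorProduct.tmul_add, TensorProduct.add_tmul, Algebra.TensorProduct.one_def]
        abel))
    (algHom_ext (by intro g; simp) (by intro v; simp))
    (algHom_ext (by intro g; simp) (by intro v; simp))

lemma comul_of (g : G) : Coalgebra.comul (R := R) (of ρ g) = of ρ g ⊗ₜ[R] of ρ g :=
  comulHom_of ρ g

lemma comul_ι (v : V) :
    Coalgebra.comul (R := R) (ι ρ v) = 1 ⊗ₜ[R] ι ρ v + ι ρ v ⊗ₜ[R] 1 :=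
  comulHom_ι ρ v

lemma counit_of (g : G) : Coalgebra.counit (R := R) (of ρ g) = 1 := counitHom_of ρ g

lemma counit_ι (v : V) : Coalgebra.counit (R := R) (ι ρ v) = 0 := counitHom_ι ρ v

/-- The antipode as a linear map. -/
def antipodeLin : SmashProduct ρ →ₗ[R] SmashProduct ρ :=
  (MulOpposite.opLinearEquiv R).symm.toLinearMap ∘ₗ (antipodeHom ρ).toLinearMap

lemma antipodeLin_of (g : G) : antipodeLin ρ (of ρ g) = of ρ g⁻¹ := by simp [antipodeLin]

lemma antipodeLin_ι (v : V) : antipodeLin ρ (ι ρ v) = -ι ρ v := by simp [antipodeLin]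

lemma antipodeLin_algebraMap (r : R) :
    antipodeLin ρ (algebraMap R _ r) = algebraMap R _ r := by
  simp [antipodeLin, AlgHom.commutes, MulOpposite.algebraMap_apply]

lemma antipodeLin_mul (a b : SmashProduct ρ) :
    antipodeLin ρ (a * b) = antipodeLin ρ b * antipodeLin ρ a := by
  simp [antipodeLin]

lemma antipodeLin_one : antipodeLin ρ 1 = 1 := by simp [antipodeLin]

open Coalgebra in
instance : HopfAlgebra R (SmashProduct ρ) where
  antipode := antipodeLin ρ
  mul_antipode_rTensor_comul := by
    ext a
    induction a using SmashProduct.induction with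
    | algebraMap r =>
      simp [Algebra.TensorProduct.algebraMap_apply, antipodeLin_algebraMap]
    | of g =>
      simp [comul_of, counit_of, antipodeLin_of, ← map_mul]
    | ι v => simp [comul_ι, counit_ι, antipodeLin_ι, antipodeLin_one]
    | add a b ha hb => rw [map_add, ha, hb, map_add]
    | mul a b ha hb =>
      simp only [LinearMap.comp_apply] at ha hb ⊢
      have key : ∀ x y : SmashProduct ρ ⊗[R] SmashProduct ρ,
          LinearMap.mul' R _ ((antipodeLin ρ).rTensor _ (x * y)) =
          LinearMap.mul' R _ ((antipodeLin ρ).rTensor _ ((1 ⊗ₜ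
            LinearMap.mul' R _ ((antipodeLin ρ).rTensor _ x)) * y)) := by
        intro x y
        induction x with
        | zero => simp
        | add x₁ x₂ h₁ h₂ => simp only [add_mul, map_add, h₁, h₂, TensorProduct.tmul_add]
        | tmul a₁ a₂ =>
          induction y with
          | zero => simp
          | add y₁ y₂ h₁ h₂ => simp only [mul_add, map_add, h₁, h₂]
          | tmul b₁ b₂ => simp [antipodeLin_mul, mul_assoc]
      rw [Bialgebra.comul_mul, key, ha]
      have : (1 : SmashProduct ρ) ⊗ₜ[R] (Algebra.linearMap R (SmashProduct ρ)) (counit a) =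
          counit (R := R) a • (1 : SmashProduct ρ ⊗[R] SmashProduct ρ) := by
        rw [Algebra.linearMap_apply, Algebra.algebraMap_eq_smul_one, TensorProduct.tmul_smul,
          Algebra.TensorProduct.one_def]
      rw [this, smul_mul_assoc, one_mul, map_smul, map_smul, hb, Bialgebra.counit_mul]
      simp [Algebra.smul_def]
  mul_antipode_lTensor_comul := by
    ext a
    induction a using SmashProduct.induction with
    | algebraMap r =>
      simp [Algebra.TensorProduct.algebraMap_apply, antipodeLin_one]
    | of g =>
      simp [comul_of, counit_of, antipodeLin_of, ← map_mul]
    | ι v => simp [comul_ι, counit_ι, antipodeLin_ι, antipodeLin_one]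
    | add a b ha hb => rw [map_add, ha, hb, map_add]
    | mul a b ha hb =>
      simp only [LinearMap.comp_apply] at ha hb ⊢
      have key : ∀ x y : SmashProduct ρ ⊗[R] SmashProduct ρ,
          LinearMap.mul' R _ ((antipodeLin ρ).lTensor _ (x * y)) =
          LinearMap.mul' R _ ((antipodeLin ρ).lTensor _ (x *
            (LinearMap.mul' R _ ((antipodeLin ρ).lTensor _ y) ⊗ₜ 1))) := by
        intro x y
        induction y with
        | zero => simp
        | add x₁ x₂ h₁ h₂ => simp only [mul_add, map_add, h₁, h₂, TensorProduct.add_tmul]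
        | tmul b₁ b₂ =>
          induction x with
          | zero => simp
          | add y₁ y₂ h₁ h₂ => simp only [add_mul, map_add, h₁, h₂]
          | tmul a₁ a₂ => simp [antipodeLin_mul, mul_assoc]
      rw [Bialgebra.comul_mul, key, hb]
      have : (Algebra.linearMap R (SmashProduct ρ)) (counit b) ⊗ₜ[R] (1 : SmashProduct ρ) =
          counit (R := R) b • (1 : SmashProduct ρ ⊗[R] SmashProduct ρ) := by
        rw [Algebra.linearMap_apply, Algebra.algebraMap_eq_smul_one, ← TensorProduct.smul_tmul',
          Algebra.TensorProduct.one_def]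
      rw [this, mul_smul_comm, mul_one, map_smul, map_smul, ha, Bialgebra.counit_mul]
      rw [Algebra.linearMap_apply, Algebra.linearMap_apply, mul_comm, map_mul, Algebra.smul_def]

/-- The canonical algebra map `Sym_R V → R[G] ⋉ Sym_R V`. -/
def symHom : SymmetricAlgebra R V →ₐ[R] SmashProduct ρ :=
  RingCon.liftₐ _ (TensorAlgebra.lift R (ι ρ)) (by
    refine RingCon.ringConGen_le.2 (fun x y h => ?_)
    induction h with
    | mul_comm x y =>
      rw [RingCon.ker_apply]
      simp [ι_mul_comm ρ x y])

lemma symHom_ι (v : V) : symHom ρ (SymmetricAlgebra.ι R V v) = ι ρ v := by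
  change TensorAlgebra.lift R (ι ρ) (TensorAlgebra.ι R v) = ι ρ v
  simp

end SmashProduct

end SmashProductDef

/-! ### Weights and their sums -/

section Weights

variable (R H : Type*) [CommRing R] [Ring H] [HopfAlgebra R H]

/-- A weight of `H` is an `R`-algebra map `H → R`. Weights are multiplied by convolution. -/
abbrev HopfWeight : Type _ := WithConv (H →ₐ[R] R)

variable {R H}

/-- The inverse of a weight under convolution is its composite with the antipode. -/
def HopfWeight.inv (f : HopfWeight R H) : HopfWeight R H :=
  WithConv.toConv (AlgHom.ofLinearMap (f.ofConv.toLinearMap ∘ₗ HopfAlgebra.antipode R)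
    (by simp)
    (by intro x y; simp [HopfAlgebra.antipode_mul_antidistrib, mul_comm]))

/-- The weights of a Hopf algebra form a group under convolution. -/
instance HopfWeight.instGroup : Group (HopfWeight R H) :=
  { (inferInstance : Monoid (HopfWeight R H)) with
    inv := HopfWeight.inv
    inv_mul_cancel := by
      intro f
      apply WithConv.ofConv_injective
      apply AlgHom.ext
      intro a
      change (HopfWeight.inv f * f) a = (1 : HopfWeight R H) a
      rw [AlgHom.convMul_apply, AlgHom.convOne_apply]
      have h := congrArg f.ofConv (HopfAlgebra.mul_antipode_rTensor_comul_apply (R := R) a)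
      rw [AlgHom.commutes] at h
      rw [← h]
      generalize Coalgebra.comul (R := R) a = z
      induction z with
      | zero => simp
      | add x y hx hy => simp only [map_add, hx, hy]
      | tmul x y =>
        simp only [LinearMap.rTensor_tmul, LinearMap.mul'_apply, map_mul,
          Algebra.TensorProduct.lift_tmul]
        rfl }

/-- The functional `Σ_Π = ∑_{γ ∈ Π} γ` on `H`, for a finite group `Π` of weights. -/
def weightSum (S : Subgroup (HopfWeight R H)) [Fintype S] : H →ₗ[R] R :=
  ∑ γ : S, (γ : HopfWeight R H).ofConv.toLinearMap

end Weights

/-! ### The degenerate affine Hecke algebra with trivial parameter -/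

section Hecke

variable {ι K M N : Type*} [Field K] [AddCommGroup M] [Module K M]
  [AddCommGroup N] [Module K N]

namespace RootPairing

variable (P : RootPairing ι K M N)

lemma smul_mem_rootSpan_int (w : P.weylGroup) {x : M} (hx : x ∈ P.rootSpan ℤ) :
    w • x ∈ P.rootSpan ℤ := by
  induction hx using Submodule.span_induction with
  | mem x hx =>
    obtain ⟨i, rfl⟩ := hx
    exact Submodule.subset_span ⟨(w : P.Aut).indexEquiv i,
      Equiv.root_indexEquiv_eq_smul P i (w : P.Aut)⟩
  | zero => rw [smul_zero]; exact Submodule.zero_mem _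
  | add x y _ _ hx hy => rw [smul_add]; exact Submodule.add_mem _ hx hy
  | smul n x _ hx => rw [smul_comm]; exact Submodule.smul_mem _ n hx

/-- The action of the Weyl group on the root lattice. -/
def rootLatticeRep : Representation ℤ P.weylGroup (P.rootSpan ℤ) where
  toFun w :=
    { toFun := fun x => ⟨w • (x : M), P.smul_mem_rootSpan_int w x.2⟩
      map_add' := fun x y => Subtype.ext (smul_add w (x : M) (y : M))
      map_smul' := fun n x => Subtype.ext (smul_comm w n (x : M)) }
  map_one' := by ext x; exact one_smul _ (x : M)
  map_mul' w w' := by ext x; exact mul_smul w w' (x : M)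

variable (R : Type*) [CommRing R]

/-- The `R`-module `𝔥* = R ⊗_ℤ Q`, where `Q` is the root lattice. -/
abbrev HStar : Type _ := R ⊗[ℤ] P.rootSpan ℤ

/-- The action of the Weyl group on `𝔥* = R ⊗_ℤ Q`. -/
def hStarRep : Representation R P.weylGroup (P.HStar R) where
  toFun w := (P.rootLatticeRep w).baseChange R
  map_one' := by rw [map_one]; exact LinearMap.baseChange_one _ _
  map_mul' w w' := by rw [map_mul]; exact LinearMap.baseChange_mul _ _

/-- The root `α_i`, as an element of `𝔥* = R ⊗_ℤ Q`. -/
def hStarRoot (i : ι) : P.HStar R := 1 ⊗ₜ P.rootSpanMem ℤ i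

/-- The degenerate affine Hecke algebra with trivial parameter, `H = RW ⋉ Sym_R(𝔥*)`. -/
abbrev DegHecke : Type _ := SmashProduct (P.hStarRep R)

variable [CharZero K] [P.IsCrystallographic] [Fintype ι]

/-- A root of an irreducible root system is short if no root has smaller length, for the canonical
Weyl-group-invariant form. In the simply laced types all roots are short. -/
def IsShortRoot (i : ι) : Prop :=
  ∀ j, (P.posRootForm ℤ).rootLength i ≤ (P.posRootForm ℤ).rootLength j

end RootPairing

end Hecke

end

/-! ### Sums over elementary abelian 2-groups in characteristic two -/

/-! The target `R` is commutative, so a weight `γ` is constant on Weyl orbits in `𝔥*`. Comparing `γ`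
on `α_j` and `s_i(α_j)` gives `⟨α_j, α_i^∨⟩ γ(α_i) = 0`. As `R` is a domain, each `α_i^∨` with
`γ(α_i) ≠ 0` pairs to zero in `R` with every root. Taking `j = i` forces `2 = 0`, so away from
characteristic two `γ` kills `𝔥*`.

In characteristic two the roots not killed by `γ` form a reflection-stable set `E` whose coroots are
even on all roots. If `E` is nonempty, it spans by irreducibility, so every root is non-orthogonal
to some member of `E`. Hence `E` contains every short root (`IsShortRoot.mem_of_even`). It contains
at most one simple root (`Base.eq_of_mem_of_even`), and type `G₂` admits no such nonempty set
(`IsG2.eq_empty_of_even`). So `γ` kills `𝔥*` in type `G₂` or when two simple roots are short. If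
`α_s` is the only short simple root, it is the only simple root on which `γ` may be nonzero.

Reflections are involutions, so in characteristic two weights are trivial on `W`. They are then
determined by additive functions on `𝔥*`, and every weight squares to the identity: order 4 never
occurs and `Π` is elementary abelian. Summing over `Π` is summing over subsets of a basis, and
`Σ_Π(α_s^n)` is a sum of `n`-th powers of subset sums. After expansion, a monomial that misses some
generator occurs equally often with and without it, hence cancels. The surviving monomials give the
multinomial formula (`sum_bool_sum_pow`), and Frobenius gives the vanishing by binary digits
(`sum_bool_prod_sum_eq_zero`). -/

section CharTwoSums

variable {R : Type*} [CommRing R] [CharP R 2] {k : ℕ}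

/-- Flipping coordinate `i` is a fixed-point-free involution pairing equal terms, which cancel in
characteristic two. -/
lemma sum_bool_eq_zero_of_update (F : (Fin k → Bool) → R) (i : Fin k)
    (hF : ∀ p b, F (Function.update p i b) = F p) : ∑ p, F p = 0 := by
  refine Finset.sum_involution (fun p _ => Function.update p i (!p i)) ?_ ?_ ?_ ?_
  · intro p _
    rw [hF, CharTwo.add_self_eq_zero]
  · intro p _ _ h
    simpa using congrFun h i
  · simp
  · simp

/-- Each term of the expanded product involves at most `card τ < k` coordinates, so it is
independent of some coordinate and its sum over `p` cancels. -/
lemma sum_bool_prod_sum_eq_zero {τ : Type*} [Fintype τ] (hτ : Fintype.card τ < k)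
    (a : τ → Fin k → R) :
    ∑ p : Fin k → Bool, ∏ t, ∑ i, (if p i then a t i else 0) = 0 := by
  classical
  simp_rw [Fintype.prod_sum]
  rw [Finset.sum_comm]
  refine Finset.sum_eq_zero fun q _ => ?_
  obtain ⟨i, hi⟩ : ∃ i, ∀ t, q t ≠ i := by
    by_contra! h
    have := Fintype.card_le_of_surjective q h
    simp at this
    omega
  refine sum_bool_eq_zero_of_update _ i fun p b => ?_
  simp [Function.update_of_ne (hi _)]

/-- A monomial with full support is nonzero at most for the full subset; any other ignores some
coordinate, and its sum over subsets cancels. -/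
lemma sum_bool_sum_pow (c : Fin k → R) (n : ℕ) :
    ∑ p : Fin k → Bool, (∑ i, (if p i then c i else 0)) ^ n =
      ∑ l ∈ (Finset.piAntidiag (Finset.univ : Finset (Fin k)) n).filter (fun l => ∀ i, 0 < l i),
        (Nat.multinomial Finset.univ l : R) * ∏ i, c i ^ l i := by
  simp_rw [Finset.sum_pow_eq_sum_piAntidiag]
  rw [Finset.sum_comm, Finset.sum_filter]
  refine Finset.sum_congr rfl fun l _ => ?_
  rw [← Finset.mul_sum]
  split_ifs with h
  · congr 1
    rw [Finset.sum_eq_single (fun _ => true)]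
    · simp
    · intro p _ hp
      obtain ⟨i, hi⟩ := Function.ne_iff.1 hp
      refine Finset.prod_eq_zero (Finset.mem_univ i) ?_
      simp [Bool.eq_false_iff.2 hi, (h i).ne']
    · simp
  · push Not at h
    obtain ⟨i, hi⟩ := h
    rw [sum_bool_eq_zero_of_update _ i, mul_zero]
    intro p b
    refine Finset.prod_congr rfl fun j _ => ?_
    rcases eq_or_ne j i with rfl | hj
    · simp [Nat.le_zero.1 hi]
    · rw [Function.update_of_ne hj]

end CharTwoSums

/-! ### Elementary abelian 2-groups and their generating families -/

section ElementaryAbelian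

/-- Subset products of generators exhaust the group; as there are `2 ^ k` subsets and `2 ^ k`
elements, each element arises exactly once. Hence any `k` generators serve as a basis. -/
lemma sum_eq_sum_bool_of_closure {G A : Type*} [CommGroup G] [Fintype G] [AddCommMonoid A] {k : ℕ}
    (hG : ∀ x : G, x * x = 1) (hcard : Fintype.card G = 2 ^ k) (g : Fin k → G)
    (hg : Subgroup.closure (Set.range g) = ⊤) (F : G → A) :
    ∑ x, F x = ∑ p : Fin k → Bool, F (∏ i, if p i then g i else 1) := by
  have hsurj : Function.Surjective fun p : Fin k → Bool => ∏ i, if p i then g i else 1 := by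
    intro x
    have hx : x ∈ Subgroup.closure (Set.range g) := hg ▸ Subgroup.mem_top x
    induction hx using Subgroup.closure_induction with
    | mem x hx =>
      obtain ⟨i, rfl⟩ := hx
      exact ⟨fun j => decide (j = i), by simp⟩
    | one => exact ⟨fun _ => false, by simp⟩
    | mul x y _ _ hx hy =>
      obtain ⟨p, rfl⟩ := hx
      obtain ⟨q, rfl⟩ := hy
      -- Exponents add modulo 2, so products of subset products correspond to symmetric differences.
      refine ⟨fun i => xor (p i) (q i), ?_⟩
      simp only [← Finset.prod_mul_distrib]
      refine Finset.prod_congr rfl fun i _ => ?_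
      by_cases hp : p i = true <;> by_cases hq : q i = true <;> simp [hp, hq, hG]
    | inv x _ hx =>
      obtain ⟨p, rfl⟩ := hx
      exact ⟨p, eq_inv_of_mul_eq_one_left (hG _)⟩
  have hbij := (Fintype.bijective_iff_surjective_and_card _).2 ⟨hsurj, by simp [hcard]⟩
  exact (hbij.sum_comp F).symm

lemma exists_mulEquiv_pi_zmod_two {G : Type*} [CommGroup G] [Finite G]
    (hG : ∀ x : G, x * x = 1) : ∃ k : ℕ, Nonempty (G ≃* Multiplicative (Fin k → ZMod 2)) := by
  let _ : Module (ZMod 2) (Additive G) := AddCommGroup.zmodModule (n := 2) fun x => by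
    rw [two_nsmul]
    exact hG x.toMul
  exact ⟨_, ⟨AddEquiv.toMultiplicativeRight
    (Module.finBasis (ZMod 2) (Additive G)).equivFun.toAddEquiv⟩⟩

lemma closure_range_single_eq_top {G : Type*} [CommGroup G] {k : ℕ}
    (e : G ≃* Multiplicative (Fin k → ZMod 2)) :
    Subgroup.closure (Set.range fun i => e.symm (Multiplicative.ofAdd (Pi.single i 1))) = ⊤ := by
  rw [eq_top_iff]
  intro x _
  obtain ⟨p, rfl⟩ := e.symm.surjective x
  obtain ⟨p, rfl⟩ := Multiplicative.ofAdd.surjective p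
  rw [← Finset.univ_sum_single p, ofAdd_sum, map_prod]
  refine Subgroup.prod_mem _ fun i _ => ?_
  obtain h | h : p i = 0 ∨ p i = 1 := by
    generalize p i = a
    revert a
    decide
  · simp [h]
  · rw [h]
    exact Subgroup.subset_closure ⟨i, rfl⟩

end ElementaryAbelian

/-! ### Reflection-stable sets of roots whose coroots are divisible by two -/

namespace RootPairing

variable {ι K M N : Type*} [Field K] [AddCommGroup M] [Module K M]
  [AddCommGroup N] [Module K N] {P : RootPairing ι K M N}

lemma span_root_image_mem_invtSubmodule {E : Set ι} {j : ι}
    (hE : ∀ i ∈ E, P.reflectionPerm j i ∈ E) :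
    Submodule.span K (P.root '' E) ∈ Module.End.invtSubmodule (P.reflection j : M →ₗ[K] M) := by
  rw [Module.End.mem_invtSubmodule, Submodule.span_le]
  rintro _ ⟨i, hi, rfl⟩
  change P.reflection j (P.root i) ∈ Submodule.span K (P.root '' E)
  rw [← P.root_reflectionPerm]
  exact Submodule.subset_span ⟨_, hE i hi, rfl⟩

lemma mem_of_root_eq_or_eq_neg {E : Set ι} (hE : ∀ i ∈ E, ∀ j, P.reflectionPerm j i ∈ E)
    {i m : ι} (hm : m ∈ E) (h : P.root i = P.root m ∨ P.root i = -P.root m) : i ∈ E := by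
  rcases h with h | h
  · rwa [P.root.injective h]
  -- The negative of a root is its image under its own reflection.
  · have : i = P.reflectionPerm m m := P.root.injective (by simp [P.root_reflectionPerm, h])
    exact this ▸ hE m hm m

variable [CharZero K] [P.IsCrystallographic]

/-- The span of `E` is nonzero and invariant under all reflections, hence everything. A coroot
vanishing on `E` would then vanish on its own root, where its value is 2. -/
lemma exists_mem_pairingIn_ne_zero [P.IsIrreducible] {E : Set ι} (hne : E.Nonempty)
    (hE : ∀ i ∈ E, ∀ j, P.reflectionPerm j i ∈ E) (i : ι) :
    ∃ m ∈ E, P.pairingIn ℤ i m ≠ 0 := by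
  by_contra! h
  have htop : Submodule.span K (P.root '' E) = ⊤ := by
    refine IsIrreducible.eq_top_of_invtSubmodule_reflection (P := P) _
      (fun j => span_root_image_mem_invtSubmodule fun i hi => hE i hi j) ?_
    obtain ⟨m, hm⟩ := hne
    intro h0
    have := Submodule.subset_span (R := K) (Set.mem_image_of_mem P.root hm)
    exact P.ne_zero m (by simpa [h0] using this)
  have hle : Submodule.span K (P.root '' E) ≤ LinearMap.ker (P.coroot' i) := by
    rw [Submodule.span_le]
    rintro _ ⟨m, hm, rfl⟩
    have h1 := h m hm
    rw [P.pairingIn_eq_zero_iff] at h1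
    simp [← P.algebraMap_pairingIn ℤ, h1]
  have h2 : P.root i ∈ LinearMap.ker (P.coroot' i) := hle (htop ▸ Submodule.mem_top)
  simp at h2

variable [Finite ι] [P.IsReduced]

/-- For non-proportional, non-orthogonal roots of a reduced crystallographic system, one of the two
pairings is `±1`. -/
lemma eq_or_eq_neg_of_even {i j : ι} (hi : Even (P.pairingIn ℤ j i))
    (hj : Even (P.pairingIn ℤ i j)) (h0 : P.pairingIn ℤ i j ≠ 0) :
    P.root i = P.root j ∨ P.root i = -P.root j := by
  by_contra! h
  have := P.pairingIn_pairingIn_mem_set_of_isCrystal_of_isRed' i j h.1 h.2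
  simp only [Set.mem_insert_iff, Set.mem_singleton_iff, Prod.mk.injEq] at this
  rw [Int.even_iff] at hi hj
  omega

variable [P.IsIrreducible]

/-- Pairings of non-proportional roots in `G₂` are `0`, `±1` or `±3`, so an even one is zero. A
nonempty `E` would therefore contain every root, including one whose coroot takes the odd value
`-3`. -/
lemma IsG2.eq_empty_of_even (hG : P.IsG2) {E : Set ι}
    (hE : ∀ i ∈ E, ∀ j, P.reflectionPerm j i ∈ E)
    (heven : ∀ i ∈ E, ∀ j, Even (P.pairingIn ℤ j i)) : E = ∅ := by
  by_contra hne
  obtain ⟨i, j, hij⟩ := hG.exists_pairingIn_neg_three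
  obtain ⟨m, hm, h0⟩ := exists_mem_pairingIn_ne_zero (Set.nonempty_iff_ne_empty.2 hne) hE j
  have hmj : P.root j = P.root m ∨ P.root j = -P.root m := by
    by_contra! h
    have := IsG2.pairingIn_mem_zero_one_three P j m h.1 h.2
    have h2 := heven m hm j
    rw [Int.even_iff] at h2
    simp only [Set.mem_insert_iff, Set.mem_singleton_iff] at this
    omega
  have := heven j (mem_of_root_eq_or_eq_neg hE hm hmj) i
  rw [hij, Int.even_iff] at this
  omega

/-- At most one simple root has a coroot divisible by two. -/
lemma Base.eq_of_mem_of_even (b : P.Base) {E : Set ι}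
    (hE : ∀ i ∈ E, ∀ j, P.reflectionPerm j i ∈ E)
    (heven : ∀ i ∈ E, ∀ j, Even (P.pairingIn ℤ j i))
    {i j : ι} (hi : i ∈ b.support) (hj : j ∈ b.support) (hiE : i ∈ E) (hjE : j ∈ E) : i = j := by
  by_contra hij
  set q := Submodule.span K (P.root '' {m | m ∈ b.support ∧ m ≠ j}) with hq
  have hjq : P.root j ∉ q := by
    have hsub : {m | m ∈ b.support ∧ m ≠ j} ⊆ (b.support : Set ι) := fun m hm => hm.1
    rw [hq, (b.linearIndepOn_root.mono hsub).notMem_span_iff]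
    exact ⟨b.linearIndepOn_root.mono (Set.insert_subset hj hsub), fun h => h.2 rfl⟩
  -- The span of `E'` is stable under simple reflections: those other than `s_j` preserve `q`, while
  -- `s_j` fixes the roots of `E'`, which are orthogonal to `α_j` by evenness. It contains `α_i`, so
  -- irreducibility makes it everything, although it lies in `q`, which misses `α_j`.
  set E' : Set ι := {m | m ∈ E ∧ P.root m ∈ q}
  have htop : Submodule.span K (P.root '' E') = ⊤ := by
    refine IsIrreducible.eq_top_of_invtSubmodule_reflection (P := P) _
      ((b.forall_mem_support_invtSubmodule_iff _).1
        fun a ha => span_root_image_mem_invtSubmodule fun m hm => ⟨hE m hm.1 a, ?_⟩) ?_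
    · rw [P.root_reflectionPerm, P.reflection_apply_root' ℤ]
      rcases eq_or_ne a j with rfl | haj
      · suffices P.pairingIn ℤ m a = 0 by simpa [this] using hm.2
        by_contra h0
        rcases eq_or_eq_neg_of_even (heven m hm.1 a) (heven a hjE m) h0 with h | h
        · exact hjq (h ▸ hm.2)
        · exact hjq (neg_mem_iff.1 (h ▸ hm.2))
      · exact sub_mem hm.2 (zsmul_mem (Submodule.subset_span (Set.mem_image_of_mem P.root
          (show a ∈ {m | m ∈ b.support ∧ m ≠ j} from ⟨ha, haj⟩))) _)
    · intro h0
      have : P.root i ∈ Submodule.span K (P.root '' E') :=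
        Submodule.subset_span (Set.mem_image_of_mem P.root (show i ∈ E' from
          ⟨hiE, Submodule.subset_span (Set.mem_image_of_mem P.root ⟨hi, hij⟩)⟩))
      exact P.ne_zero i (by simpa [h0] using this)
  have hle : Submodule.span K (P.root '' E') ≤ q := by
    rw [Submodule.span_le]
    rintro _ ⟨m, hm, rfl⟩
    exact hm.2
  exact hjq (hle (htop ▸ Submodule.mem_top))

end RootPairing

/-! ### Short roots and reflection-stable sets with even coroots -/

namespace RootPairing

variable {ι K M N : Type*} [Field K] [AddCommGroup M] [Module K M]
  [AddCommGroup N] [Module K N] {P : RootPairing ι K M N}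
  [Fintype ι] [CharZero K] [P.IsCrystallographic] [P.IsIrreducible]

/-- Some `m ∈ E` has a nonzero even pairing with `i`. Unless `i` and `m` agree up to sign, a pairing
of absolute value at least 2 makes `i` strictly longer than `m`. -/
lemma IsShortRoot.mem_of_even {i : ι} (hi : P.IsShortRoot i) {E : Set ι} (hne : E.Nonempty)
    (hE : ∀ i ∈ E, ∀ j, P.reflectionPerm j i ∈ E)
    (heven : ∀ i ∈ E, ∀ j, Even (P.pairingIn ℤ j i)) : i ∈ E := by
  obtain ⟨m, hm, h0⟩ := exists_mem_pairingIn_ne_zero hne hE i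
  refine mem_of_root_eq_or_eq_neg hE hm ?_
  by_contra! h
  refine (hi m).not_gt
    ((P.posRootForm ℤ).rootLength_lt_of_pairingIn_notMem h.1 h.2 fun h1 => ?_)
  have h2 := heven m hm i
  rw [Int.even_iff] at h2
  simp only [Set.mem_insert_iff, Set.mem_singleton_iff] at h1
  omega

end RootPairing

/-! ### Weights of smash products -/

namespace SmashProduct

variable {R G V : Type*} [CommRing R] [Group G] [AddCommGroup V] [Module R V]
  {ρ : Representation R G V}

/-- Conjugation by `g` becomes trivial in the commutative target. -/
lemma algHom_ι_apply_eq (f : SmashProduct ρ →ₐ[R] R) (g : G) (v : V) :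
    f (ι ρ (ρ g v)) = f (ι ρ v) := by
  rw [← of_mul_ι_mul_of_inv, map_mul, map_mul, mul_right_comm, ← map_mul f, ← map_mul (of ρ),
    mul_inv_cancel, map_one, map_one, one_mul]

lemma weight_mul_of (γ δ : HopfWeight R (SmashProduct ρ)) (g : G) :
    (γ * δ) (of ρ g) = γ (of ρ g) * δ (of ρ g) := by
  rw [AlgHom.convMul_apply, comul_of]
  simp

lemma weight_mul_ι (γ δ : HopfWeight R (SmashProduct ρ)) (v : V) :
    (γ * δ) (ι ρ v) = γ (ι ρ v) + δ (ι ρ v) := by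
  rw [AlgHom.convMul_apply, comul_ι]
  simp [add_comm]

lemma weight_eq_counit_symHom {γ : HopfWeight R (SmashProduct ρ)} (hγ : ∀ v, γ (ι ρ v) = 0)
    (x : SymmetricAlgebra R V) :
    γ (symHom ρ x) = Coalgebra.counit (R := R) (symHom ρ x) := by
  have : γ.ofConv.comp (symHom ρ) = (Bialgebra.counitAlgHom R _).comp (symHom ρ) := by
    apply SymmetricAlgebra.algHom_ext
    ext v
    simp [symHom_ι, hγ, counit_ι]
  exact DFunLike.congr_fun this x

lemma counit_symHom_eq_zero {x : SymmetricAlgebra R V}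
    (hx : x ∈ Ideal.span (Set.range (SymmetricAlgebra.ι R V))) :
    Coalgebra.counit (R := R) (symHom ρ x) = 0 := by
  have hle : Ideal.span (Set.range (SymmetricAlgebra.ι R V)) ≤
      RingHom.ker ((Bialgebra.counitAlgHom R _).comp (symHom ρ)) := by
    rw [Ideal.span_le]
    rintro _ ⟨v, rfl⟩
    simp [symHom_ι, counit_ι]
  exact hle hx

lemma weight_mul_self_of_charTwo [CharP R 2] {γ : HopfWeight R (SmashProduct ρ)}
    (hγ : ∀ g, γ (of ρ g) = 1) : γ * γ = 1 := by
  apply WithConv.ext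
  apply algHom_ext
  · intro g
    rw [weight_mul_of, hγ, mul_one, AlgHom.convOne_apply, counit_of, map_one]
  · intro v
    rw [weight_mul_ι, CharTwo.add_self_eq_zero, AlgHom.convOne_apply, counit_ι, map_zero]

end SmashProduct

lemma weightSum_apply {R H : Type*} [CommRing R] [Ring H] [HopfAlgebra R H]
    (S : Subgroup (HopfWeight R H)) [Fintype S] (x : H) :
    weightSum S x = ∑ γ : S, (γ : HopfWeight R H) x := by
  simp [weightSum]

/-! ### Sums over elementary abelian groups of weights -/

section PrimitivePowers

variable {R H : Type*} [CommRing R] [Ring H] [HopfAlgebra R H]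
  (S : Subgroup (HopfWeight R H)) [Fintype S]

/-- Evaluation at `a` is a homomorphism from `S` to the additive group of `R`, so a product of
generators evaluates to a subset sum. -/
lemma weightSum_pow_eq_sum_bool (hS : ∀ x : S, x * x = 1) {k : ℕ} (hcard : Fintype.card S = 2 ^ k)
    {a : H} (ha : ∀ γ δ : HopfWeight R H, (γ * δ) a = γ a + δ a)
    (g : Fin k → S) (hg : Subgroup.closure (Set.range g) = ⊤) (n : ℕ) :
    weightSum S (a ^ n) =
      ∑ p : Fin k → Bool, (∑ i, if p i then (g i : HopfWeight R H) a else 0) ^ n := by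
  let _ : CommGroup S := { (inferInstance : Group S) with
    mul_comm := fun x y => Commute.of_orderOf_dvd_two
      (fun z => orderOf_dvd_of_pow_eq_one (by rw [pow_two, hS])) x y }
  let ev : S →* Multiplicative R := MonoidHom.mk' (fun γ => .ofAdd ((γ : HopfWeight R H) a))
    fun γ δ => congrArg Multiplicative.ofAdd (ha γ δ)
  rw [weightSum_apply]
  simp_rw [map_pow]
  rw [sum_eq_sum_bool_of_closure hS hcard g hg fun γ : S => (γ : HopfWeight R H) a ^ n]
  refine Finset.sum_congr rfl fun p _ => congrArg (· ^ n) ?_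
  have h := congrArg Multiplicative.toAdd
    (map_prod ev (fun i => if p i then g i else 1) Finset.univ)
  rw [toAdd_prod] at h
  refine h.trans (Finset.sum_congr rfl fun i _ => ?_)
  split_ifs with hp
  · rfl
  · simp

variable [CharP R 2]

lemma weightSum_pow_eq_sum_multinomial (hS : ∀ x : S, x * x = 1) {k : ℕ}
    (hcard : Fintype.card S = 2 ^ k)
    {a : H} (ha : ∀ γ δ : HopfWeight R H, (γ * δ) a = γ a + δ a)
    (γ : Fin k → HopfWeight R H) (hγ : Subgroup.closure (Set.range γ) = S) (n : ℕ) :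
    weightSum S (a ^ n) =
      ∑ l ∈ (Finset.piAntidiag (Finset.univ : Finset (Fin k)) n).filter (fun l => ∀ i, 0 < l i),
        (Nat.multinomial Finset.univ l : R) * ∏ i, γ i a ^ l i := by
  have hmem : ∀ i, γ i ∈ S := fun i => hγ ▸ Subgroup.subset_closure ⟨i, rfl⟩
  rw [weightSum_pow_eq_sum_bool S hS hcard ha (fun i => ⟨γ i, hmem i⟩) ?_ n]
  · exact sum_bool_sum_pow (fun i => γ i a) n
  · apply Subgroup.map_injective S.subtype_injective
    rw [MonoidHom.map_closure, ← Set.range_comp, ← MonoidHom.range_eq_map, Subgroup.range_subtype]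
    exact hγ

/-- By Frobenius, the power factors into `T.card < k` sums, each again additive in the chosen
generators, so every expanded term misses a generator. -/
lemma weightSum_pow_eq_zero_of_card_lt (hS : ∀ x : S, x * x = 1) {k : ℕ}
    (e : S ≃* Multiplicative (Fin k → ZMod 2))
    {a : H} (ha : ∀ γ δ : HopfWeight R H, (γ * δ) a = γ a + δ a)
    {T : Finset ℕ} (hT : T.card < k) :
    weightSum S (a ^ ∑ t ∈ T, 2 ^ t) = 0 := by
  let _ : CommGroup S := { (inferInstance : Group S) with
    mul_comm := fun x y => e.injective (by rw [map_mul, map_mul, mul_comm]) }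
  have hcard : Fintype.card S = 2 ^ k := by
    rw [Fintype.card_congr e.toEquiv]
    simp [ZMod.card]
  rw [weightSum_pow_eq_sum_bool S hS hcard ha _ (closure_range_single_eq_top e)]
  refine Eq.trans ?_ (sum_bool_prod_sum_eq_zero (R := R) (k := k) (τ := T) (by simpa using hT)
    fun t i =>
      ((e.symm (Multiplicative.ofAdd (Pi.single i 1)) : S) : HopfWeight R H) a ^ 2 ^ (t : ℕ))
  refine Finset.sum_congr rfl fun p _ => ?_
  rw [← Finset.prod_pow_eq_pow_sum, ← Finset.prod_coe_sort]
  refine Finset.prod_congr rfl fun t _ => ?_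
  rw [sum_pow_char_pow]
  refine Finset.sum_congr rfl fun i _ => ?_
  split_ifs <;> simp

end PrimitivePowers

/-! ### Weights of the degenerate affine Hecke algebra -/

namespace RootPairing

variable {ι K M N R : Type*} [Field K] [AddCommGroup M] [Module K M]
  [AddCommGroup N] [Module K N] {P : RootPairing ι K M N} [CommRing R]

lemma hStarRep_ofIdx_hStarRoot (i j : ι) :
    P.hStarRep R (weylGroup.ofIdx P j) (P.hStarRoot R i) =
      P.hStarRoot R (P.reflectionPerm j i) := by
  change (1 : R) ⊗ₜ[ℤ] P.rootLatticeRep (weylGroup.ofIdx P j) (P.rootSpanMem ℤ i) = _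
  refine congrArg (fun x => (1 : R) ⊗ₜ[ℤ] x) (Subtype.ext ?_)
  exact (P.root_reflectionPerm j i).symm

lemma hStarRoot_reflectionPerm [CharZero K] [P.IsCrystallographic] (i j : ι) :
    P.hStarRoot R (P.reflectionPerm j i) =
      P.hStarRoot R i - (P.pairingIn ℤ i j : R) • P.hStarRoot R j := by
  have h : P.rootSpanMem ℤ (P.reflectionPerm j i) =
      P.rootSpanMem ℤ i - P.pairingIn ℤ i j • P.rootSpanMem ℤ j := Subtype.ext <| by
    simp [P.root_reflectionPerm, P.reflection_apply_root' ℤ]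
  rw [hStarRoot, h, TensorProduct.tmul_sub, TensorProduct.tmul_smul, Int.cast_smul_eq_zsmul]
  rfl

lemma span_range_hStarRoot : Submodule.span R (Set.range (P.hStarRoot R)) = ⊤ := by
  set q := Submodule.span R (Set.range (P.hStarRoot R))
  rw [eq_top_iff]
  rintro v -
  induction v using TensorProduct.induction_on with
  | zero => exact zero_mem _
  | add x y hx hy => exact add_mem hx hy
  | tmul r x =>
    have hx : (1 : R) ⊗ₜ[ℤ] x ∈ q := by
      obtain ⟨x, hx⟩ := x
      induction hx using Submodule.span_induction with
      | mem x hx =>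
        obtain ⟨i, rfl⟩ := hx
        exact Submodule.subset_span ⟨i, rfl⟩
      | zero =>
        change (1 : R) ⊗ₜ[ℤ] (0 : P.rootSpan ℤ) ∈ q
        rw [TensorProduct.tmul_zero]
        exact q.zero_mem
      | add x y hx' hy' hx hy =>
        change (1 : R) ⊗ₜ[ℤ] ((⟨x, hx'⟩ : P.rootSpan ℤ) + ⟨y, hy'⟩) ∈ q
        rw [TensorProduct.tmul_add]
        exact q.add_mem hx hy
      | smul n x hx' hx =>
        change (1 : R) ⊗ₜ[ℤ] (n • (⟨x, hx'⟩ : P.rootSpan ℤ)) ∈ q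
        rw [TensorProduct.tmul_smul]
        exact zsmul_mem hx n
    simpa [TensorProduct.smul_tmul'] using Submodule.smul_mem _ r hx

/-- The roots not killed by a weight. -/
def weightSupport (γ : HopfWeight R (P.DegHecke R)) : Set ι :=
  {i | γ (SmashProduct.ι (P.hStarRep R) (P.hStarRoot R i)) ≠ 0}

variable {γ : HopfWeight R (P.DegHecke R)}

lemma weight_eq_zero_of_weightSupport_eq_empty (hγ : weightSupport γ = ∅) (v : P.HStar R) :
    γ (SmashProduct.ι (P.hStarRep R) v) = 0 := by
  have hle : Submodule.span R (Set.range (P.hStarRoot R)) ≤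
      LinearMap.ker (γ.ofConv.toLinearMap ∘ₗ SmashProduct.ι (P.hStarRep R)) := by
    rw [Submodule.span_le]
    rintro _ ⟨i, rfl⟩
    by_contra hi
    exact (hγ ▸ hi : i ∈ (∅ : Set ι))
  exact hle (span_range_hStarRoot (P := P) (R := R) ▸ Submodule.mem_top)

lemma reflectionPerm_mem_weightSupport {i : ι} (hi : i ∈ weightSupport γ) (j : ι) :
    P.reflectionPerm j i ∈ weightSupport γ := by
  rwa [weightSupport, Set.mem_ofPred_eq, ← hStarRep_ofIdx_hStarRoot,
    SmashProduct.algHom_ι_apply_eq]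

variable [IsDomain R]

/-- A reflection squares to 1, so its value in the domain `R` is `±1`, and these coincide in
characteristic two. Reflections generate the Weyl group. -/
lemma weight_of_eq_one [CharP R 2] (γ : HopfWeight R (P.DegHecke R)) (w : P.weylGroup) :
    γ (SmashProduct.of (P.hStarRep R) w) = 1 := by
  obtain ⟨w, hw⟩ := w
  induction hw using weylGroup.induction with
  | mem i =>
    set s : P.weylGroup := ⟨Equiv.reflection P i, P.reflection_mem_weylGroup i⟩
    have hss : s * s = 1 := Subtype.ext <| by
      simpa [Equiv.reflection_inv] using mul_inv_cancel (Equiv.reflection P i)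
    have h : γ (SmashProduct.of (P.hStarRep R) s) * γ (SmashProduct.of (P.hStarRep R) s) = 1 := by
      rw [← map_mul, ← map_mul, hss, map_one, map_one]
    rcases mul_self_eq_one_iff.1 h with h | h
    · exact h
    · rw [h, CharTwo.neg_eq]
  | one => exact (congrArg _ (map_one _)).trans (map_one _)
  | mul x y hx hy h1 h2 =>
    have := map_mul (SmashProduct.of (P.hStarRep R)) ⟨x, hx⟩ ⟨y, hy⟩
    have h3 := congrArg γ.ofConv this
    rw [map_mul γ.ofConv, h1, h2, mul_one] at h3
    exact h3

variable [CharZero K] [P.IsCrystallographic]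

lemma pairingIn_eq_zero_of_mem_weightSupport {i : ι} (hi : i ∈ weightSupport γ) (j : ι) :
    (P.pairingIn ℤ j i : R) = 0 := by
  have h := SmashProduct.algHom_ι_apply_eq γ.ofConv (weylGroup.ofIdx P i) (P.hStarRoot R j)
  rw [hStarRep_ofIdx_hStarRoot, hStarRoot_reflectionPerm, map_sub, map_sub, sub_eq_self,
    map_smul, map_smul, smul_eq_mul] at h
  exact (mul_eq_zero.1 h).resolve_right hi

lemma weightSupport_eq_empty_of_two_ne_zero (h2 : (2 : R) ≠ 0) : weightSupport γ = ∅ := by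
  refine Set.eq_empty_of_forall_notMem fun i hi => h2 ?_
  -- A root pairs to 2 with its own coroot.
  simpa using pairingIn_eq_zero_of_mem_weightSupport hi i

lemma even_pairingIn_of_mem_weightSupport [CharP R 2] {i : ι} (hi : i ∈ weightSupport γ) (j : ι) :
    Even (P.pairingIn ℤ j i) :=
  even_iff_two_dvd.2 <|
    (CharP.intCast_eq_zero_iff R 2 _).1 (pairingIn_eq_zero_of_mem_weightSupport hi j)

end RootPairing

/-! ### Weights on simple roots in characteristic two -/

namespace RootPairing

variable {ι K M N R : Type*} [Fintype ι] [Field K] [CharZero K]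
  [AddCommGroup M] [Module K M] [AddCommGroup N] [Module K N]
  {P : RootPairing ι K M N} [P.IsCrystallographic] [P.IsIrreducible]
  [CommRing R] [IsDomain R] [CharP R 2] {γ : HopfWeight R (P.DegHecke R)}

lemma mem_weightSupport_of_isShortRoot (hγ : (weightSupport γ).Nonempty) {i : ι}
    (hi : P.IsShortRoot i) : i ∈ weightSupport γ :=
  hi.mem_of_even hγ (fun _ h => reflectionPerm_mem_weightSupport h)
    fun _ h => even_pairingIn_of_mem_weightSupport h

variable [P.IsReduced]

lemma Base.eq_of_mem_weightSupport (b : P.Base) {i j : ι} (hi : i ∈ b.support)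
    (hj : j ∈ b.support) (hiγ : i ∈ weightSupport γ) (hjγ : j ∈ weightSupport γ) : i = j :=
  b.eq_of_mem_of_even (fun _ h => reflectionPerm_mem_weightSupport h)
    (fun _ h => even_pairingIn_of_mem_weightSupport h) hi hj hiγ hjγ

/-- If `γ` were nonzero on another simple root, its support would be nonempty and so contain the
short root `α_s` too, giving two simple roots in the support. -/
lemma weight_eq_zero_of_mem_span (b : P.Base) {s : ι} (hs : s ∈ b.support)
    (hshort : P.IsShortRoot s) {v : P.HStar R}
    (hv : v ∈ Submodule.span R (P.hStarRoot R '' {j | j ∈ b.support ∧ j ≠ s})) :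
    γ (SmashProduct.ι (P.hStarRep R) v) = 0 := by
  have hle : Submodule.span R (P.hStarRoot R '' {j | j ∈ b.support ∧ j ≠ s}) ≤
      LinearMap.ker (γ.ofConv.toLinearMap ∘ₗ SmashProduct.ι (P.hStarRep R)) := by
    rw [Submodule.span_le]
    rintro _ ⟨j, hj, rfl⟩
    by_contra h
    have hjγ : j ∈ weightSupport γ := h
    exact hj.2 (b.eq_of_mem_weightSupport hj.1 hs hjγ
      (mem_weightSupport_of_isShortRoot ⟨j, hjγ⟩ hshort))
  exact hle hv

end RootPairing

theorem theoremT7 {ι K M N R : Type*} [Fintype ι] [Field K] [CharZero K]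
    [AddCommGroup M] [Module K M] [AddCommGroup N] [Module K N]
    (P : RootPairing ι K M N) [P.IsRootSystem] [P.IsCrystallographic] [P.IsReduced]
    [P.IsIrreducible] (b : P.Base) [CommRing R] [IsDomain R] :
    -- every weight kills `𝔥*` outside the exceptional case
    ((ringChar R ≠ 2 ∨ P.IsG2 ∨
        ∃ i ∈ b.support, ∃ j ∈ b.support, i ≠ j ∧ P.IsShortRoot i ∧ P.IsShortRoot j) →
      (∀ (γ : HopfWeight R (P.DegHecke R)) (v : P.HStar R),
        γ (SmashProduct.ι (P.hStarRep R) v) = 0) ∧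
      ∀ (S : Subgroup (HopfWeight R (P.DegHecke R))) [Fintype S],
        (∀ x : SymmetricAlgebra R (P.HStar R),
          weightSum S (SmashProduct.symHom (P.hStarRep R) x) =
            (Fintype.card S : R) *
              Coalgebra.counit (R := R) (SmashProduct.symHom (P.hStarRep R) x)) ∧
        ∀ x ∈ Ideal.span (Set.range (SymmetricAlgebra.ι R (P.HStar R))),
          weightSum S (SmashProduct.symHom (P.hStarRep R) x) = 0) ∧
    -- characteristic two
    (ringChar R = 2 →
      (∀ (γ : HopfWeight R (P.DegHecke R)) (w : P.weylGroup),
        γ (SmashProduct.of (P.hStarRep R) w) = 1) ∧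
      (¬ P.IsG2 → ∀ s ∈ b.support, P.IsShortRoot s →
        (∀ j ∈ b.support, P.IsShortRoot j → j = s) →
        ∀ (S : Subgroup (HopfWeight R (P.DegHecke R))) [Fintype S],
          -- an element of order 4, or a factor without `α_s`-contribution
          (∀ (n : ℕ) (h : Fin n → P.HStar R),
            ((∃ γ ∈ S, orderOf γ = 4) ∨
              ∃ i, h i ∈ Submodule.span R
                (P.hStarRoot R '' {j | j ∈ b.support ∧ j ≠ s})) →
            weightSum S (List.ofFn fun i => SmashProduct.ι (P.hStarRep R) (h i)).prod = 0) ∧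
          -- otherwise the group is elementary abelian
          ((¬ ∃ γ ∈ S, orderOf γ = 4) →
            ∃ k : ℕ, Nonempty (S ≃* Multiplicative (Fin k → ZMod 2))) ∧
          ∀ k : ℕ, Nonempty (S ≃* Multiplicative (Fin k → ZMod 2)) →
            ∀ n : ℕ,
              (∀ γ : Fin k → HopfWeight R (P.DegHecke R),
                Subgroup.closure (Set.range γ) = S →
                weightSum S (SmashProduct.ι (P.hStarRep R) (P.hStarRoot R s) ^ n) =
                  ∑ l ∈ (Finset.piAntidiag (Finset.univ : Finset (Fin k)) n).filter
                      (fun l => ∀ i, 0 < l i),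
                    (Nat.multinomial Finset.univ l : R) *
                      ∏ i, γ i (SmashProduct.ι (P.hStarRep R) (P.hStarRoot R s)) ^ l i) ∧
              ∀ T : Finset ℕ, ∑ t ∈ T, 2 ^ t = n → T.card < k →
                weightSum S (SmashProduct.ι (P.hStarRep R) (P.hStarRoot R s) ^ n) = 0)) := by
  refine ⟨fun h => ?_, fun hR => ?_⟩
  · have hγ : ∀ (γ : HopfWeight R (P.DegHecke R)) (v : P.HStar R),
        γ (SmashProduct.ι (P.hStarRep R) v) = 0 := by
      intro γ
      refine RootPairing.weight_eq_zero_of_weightSupport_eq_empty ?_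
      by_cases h2 : (2 : R) = 0
      · have : CharP R 2 := CharTwo.of_one_ne_zero_of_two_eq_zero one_ne_zero h2
        rcases h with h | h | ⟨i, hi, j, hj, hij, hsi, hsj⟩
        · exact absurd (ringChar.eq R 2) h
        · exact h.eq_empty_of_even (fun _ h => RootPairing.reflectionPerm_mem_weightSupport h)
            fun _ h => RootPairing.even_pairingIn_of_mem_weightSupport h
        · by_contra hne
          have hne := Set.nonempty_iff_ne_empty.2 hne
          exact hij (b.eq_of_mem_weightSupport hi hj
            (RootPairing.mem_weightSupport_of_isShortRoot hne hsi)
            (RootPairing.mem_weightSupport_of_isShortRoot hne hsj))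
      · exact RootPairing.weightSupport_eq_empty_of_two_ne_zero h2
    refine ⟨hγ, fun S _ => ?_⟩
    have hS : ∀ x : SymmetricAlgebra R (P.HStar R),
        weightSum S (SmashProduct.symHom (P.hStarRep R) x) =
          (Fintype.card S : R) *
            Coalgebra.counit (R := R) (SmashProduct.symHom (P.hStarRep R) x) := fun x => by
      simp [weightSum_apply, SmashProduct.weight_eq_counit_symHom (hγ _)]
    refine ⟨hS, fun x hx => ?_⟩
    rw [hS, SmashProduct.counit_symHom_eq_zero hx, mul_zero]
  · have : CharP R 2 := hR ▸ ringChar.charP R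
    refine ⟨RootPairing.weight_of_eq_one, fun _ s hs hshort _ S _ => ?_⟩
    have hsq (γ : HopfWeight R (P.DegHecke R)) : γ * γ = 1 :=
      SmashProduct.weight_mul_self_of_charTwo (RootPairing.weight_of_eq_one γ)
    have hsqS (x : S) : x * x = 1 := Subtype.ext (hsq x)
    refine ⟨fun n h hh => ?_, fun _ => ?_, fun k ⟨e⟩ n => ⟨fun γ hγ => ?_, ?_⟩⟩
    · rcases hh with ⟨γ, _, hγ⟩ | ⟨i, hi⟩
      -- Every weight has order dividing 2, so an element of order 4 is impossible.
      · have := orderOf_dvd_of_pow_eq_one ((pow_two γ).trans (hsq γ))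
        rw [hγ] at this
        omega
      · rw [weightSum_apply]
        refine Finset.sum_eq_zero fun γ _ => ?_
        rw [map_list_prod, List.prod_eq_zero_iff]
        -- A weight is multiplicative, so the single factor `h i` that it kills makes the whole
        -- product vanish.
        refine List.mem_map.2 ⟨_, List.mem_ofFn.2 ⟨i, rfl⟩, ?_⟩
        exact RootPairing.weight_eq_zero_of_mem_span b hs hshort hi
    · let _ : CommGroup S := { (inferInstance : Group S) with
        mul_comm := fun x y => Commute.of_orderOf_dvd_two
          (fun z => orderOf_dvd_of_pow_eq_one (by rw [pow_two, hsqS])) x y }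
      exact exists_mulEquiv_pi_zmod_two hsqS
    · refine weightSum_pow_eq_sum_multinomial S hsqS ?_
        (fun γ δ => SmashProduct.weight_mul_ι γ δ _) γ hγ n
      rw [Fintype.card_congr e.toEquiv]
      simp [ZMod.card]
    · rintro T rfl hT
      exact weightSum_pow_eq_zero_of_card_lt S hsqS e
        (fun γ δ => SmashProduct.weight_mul_ι γ δ _) hT
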